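/- Let $\mathfrak B$ be a real or complex Banach space, and let $[\mathfrak B]$ be the Banach space of bounded linear operators on $\mathfrak B$ with the operator norm. For a Banach space $X$, equip $C(\mathbb R,X)$, the continuous functions $\mathbb R\to X$, with the topology of uniform convergence on compact sets, and write $\varphi^h(t):=\varphi(t+h)$. Let $A\in C(\mathbb R,[\mathfrak B])$ and $f\in C(\mathbb R,\mathfrak B)$, and let $U(t)$ be the Cauchy operator of $x'=A(t)x$, i.e. the $[\mathfrak B]$-valued solution of $U'(t)=A(t)U(t)$ $(t\in\mathbb R)$, $U(0)=I$. For $\varphi\in C(\mathbb R,\mathfrak B)$ let $\mathfrak L_\varphi^{\pm\infty}$ be the set of real sequences $(t_n)$ such that $t_n\to\pm\infty$ and $(\varphi^{t_n})$ converges in $C(\mathbb R,\mathfrak B)$ as $n\to\infty$, and put $\mathfrak L_\varphi:=\mathfrak L_\varphi^{-\infty}\cup\mathfrak L_\varphi^{+\infty}$. Define $\mathfrak L_{(A,f)}$ in the same way from the convergence of $(A^{t_n},f^{t_n})$ in $C(\mathbb R,[\mathfrak B])\times C(\mathbb R,\mathfrak B)$. A solution $\varphi$ on $\mathbb R$ of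 $x'=A(t)x+f(t)$ is called two-sided remotely compatible if $\mathfrak L_{(A,f)}\subseteq\mathfrak L_\varphi$. **Theorem 5.1.** Assume that 1. $(A,f)$ is Lagrange stable, i.e. $\{(A^h,f^h): h\in\mathbb R\}$ is a precompact subset of $C(\mathbb R,[\mathfrak B])\times C(\mathbb R,\mathfrak B)$; 2. $x'=A(t)x$ has an exponential trichotomy on $\mathbb R$ with projections $P,Q\in[\mathfrak B]$, i.e. $P^2=P$, $Q^2=Q$, $PQ=QP$, $P+Q-PQ=I$, and there are constants $\mathcal N\ge 1$, $\nu>0$ such that $$\|U(t)PU^{-1}(\tau)\|\le\mathcal Ne^{-\nu(t-\tau)}\quad(0\le\tau\le t),\qquad \|U(t)(I-P)U^{-1}(\tau)\|\le\mathcal Ne^{-\nu(\tau-t)}\quad(t\le\tau,\ \tau\ge0),$$ $$\|U(t)QU^{-1}(\tau)\|\le\mathcal Ne^{-\nu(\tau-t)}\quad(t\le\tau\le0),\qquad \|U(t)(I-Q)U^{-1}(\tau)\|\le\mathcal Ne^{-\nu(t-\tau)}\quad(\tau\le t,\ \tau\le0).$$ Let $G_A$ be the Green function $$G_A(t,\tau)=\begin{cases}U(t)PU^{-1}(\tau),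 & 0\le\tau<t,\\ -U(t)(I-P)U^{-1}(\tau), & t\le\tau,\ \tau\ge0,\\ -U(t)QU^{-1}(\tau), & t\le\tau\le 0,\\ U(t)(I-Q)U^{-1}(\tau), & \tau\le t,\ \tau\le0,\end{cases}$$ where, at points satisfying several of the conditions (these have $\tau=0$ or $\tau=t$), the first applicable line is used. Then 1. the equation $x'=A(t)x+f(t)$ has at least one two-sided remotely compatible solution $\varphi$ on $\mathbb R$; 2. this solution $\varphi$ is given by $$\varphi(t)=\int_{-\infty}^{+\infty}G_A(t,\tau)f(\tau)\,d\tau\qquad(t\in\mathbb R),$$ the integral being absolutely convergent for every $t$; 3. every solution of $x'=A(t)x+f(t)$ that is bounded on $\mathbb R$ is two-sided remotely compatible. -/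

import Mathlib

open Filter Topology MeasureTheory Set

/-- A point `x` of a dynamical system `π` on `X` with time `ℝ` is Lagrange stable if its trajectory
`{π(t, x) | t ∈ ℝ}` is a precompact subset of `X`. -/
def LagrangeStable {X : Type*} [TopologicalSpace X] (π : Flow ℝ X) (x : X) : Prop :=
  IsCompact (closure (range fun t : ℝ => π t x))

/-- The sequences `t_n → +∞` along which `π(t_n, x)` converges. -/
def limitSeqTop {X : Type*} [TopologicalSpace X] (π : Flow ℝ X) (x : X) : Set (ℕ → ℝ) :=
  {t | (∃ p : X, Tendsto (fun n => π (t n) x) atTop (𝓝 p)) ∧ Tendsto t atTop atTop}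

/-- The sequences `t_n → -∞` along which `π(t_n, x)` converges. -/
def limitSeqBot {X : Type*} [TopologicalSpace X] (π : Flow ℝ X) (x : X) : Set (ℕ → ℝ) :=
  {t | (∃ p : X, Tendsto (fun n => π (t n) x) atTop (𝓝 p)) ∧ Tendsto t atTop atBot}

/-- The set `𝔏_x = 𝔏_x^{-∞} ∪ 𝔏_x^{+∞}`. -/
def limitSeq {X : Type*} [TopologicalSpace X] (π : Flow ℝ X) (x : X) : Set (ℕ → ℝ) :=
  limitSeqBot π x ∪ limitSeqTop π x

/-- The shift (Bebutov) dynamical system on the space `C(ℝ, X)` of continuous functions with the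
topology of uniform convergence on compact sets: `φ ↦ φ^h`, `φ^h(t) = φ(t + h)`. -/
def shiftFlow (X : Type*) [TopologicalSpace X] : Flow ℝ C(ℝ, X) where
  toFun h φ := φ.comp ⟨fun t => t + h, by fun_prop⟩
  cont' := by
    apply ContinuousMap.continuous_of_continuous_uncurry
    have h : Continuous fun p : (ℝ × C(ℝ, X)) × ℝ => p.1.2 (p.2 + p.1.1) := by fun_prop
    exact h
  map_add' h₁ h₂ φ := by
    ext t
    simp only [ContinuousMap.comp_apply, ContinuousMap.coe_mk]
    congr 1
    ring
  map_zero' φ := by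
    ext t
    simp

/-- The product of two dynamical systems. -/
def prodFlow {X Y : Type*} [TopologicalSpace X] [TopologicalSpace Y] (π : Flow ℝ X)
    (σ : Flow ℝ Y) : Flow ℝ (X × Y) where
  toFun t p := (π t p.1, σ t p.2)
  cont' := by
    have h : Continuous fun q : ℝ × (X × Y) => (π q.1 q.2.1, σ q.1 q.2.2) := by fun_prop
    exact h
  map_add' s t p := by simp [Flow.map_add]
  map_zero' p := by simp

/-- `U` is an operator-valued solution of `U' = A(t) U`, `U(0) = 1`. -/
def IsCauchyOperator {R : Type*} [NormedRing R] [NormedSpace ℝ R] (A : C(ℝ, R)) (U : ℝ → R) :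
    Prop :=
  U 0 = 1 ∧ ∀ t : ℝ, HasDerivAt U (A t * U t) t

/-- Terms of the Peano-Baker series, used only to show that a Cauchy operator exists. -/
noncomputable def peanoBakerTerm {R : Type*} [NormedRing R] [NormedSpace ℝ R] (A : C(ℝ, R)) :
    ℕ → ℝ → R
  | 0 => fun _ => 1
  | n + 1 => fun t => ∫ s in (0 : ℝ)..t, A s * peanoBakerTerm A n s

theorem continuous_peanoBakerTerm {R : Type*} [NormedRing R] [NormedSpace ℝ R] [CompleteSpace R]
    (A : C(ℝ, R)) (n : ℕ) : Continuous (peanoBakerTerm A n) := by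
  induction n with
  | zero => exact continuous_const
  | succ n ih =>
    exact intervalIntegral.continuous_primitive
      (fun a b => (A.continuous.mul ih).intervalIntegrable a b) 0

theorem hasDerivAt_peanoBakerTerm {R : Type*} [NormedRing R] [NormedSpace ℝ R] [CompleteSpace R]
    (A : C(ℝ, R)) (n : ℕ) (t : ℝ) :
    HasDerivAt (peanoBakerTerm A (n + 1)) (A t * peanoBakerTerm A n t) t := by
  have hc : Continuous fun s => A s * peanoBakerTerm A n s :=
    A.continuous.mul (continuous_peanoBakerTerm A n)
  exact intervalIntegral.integral_hasDerivAt_right (hc.intervalIntegrable 0 t)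
    hc.stronglyMeasurable.stronglyMeasurableAtFilter hc.continuousAt

theorem norm_peanoBakerTerm_le {R : Type*} [NormedRing R] [NormedSpace ℝ R] [CompleteSpace R]
    (A : C(ℝ, R)) {T M : ℝ} (hM : ∀ t, |t| ≤ T → ‖A t‖ ≤ M) (n : ℕ) (t : ℝ) (ht : |t| ≤ T) :
    ‖peanoBakerTerm A n t‖ ≤ ‖(1 : R)‖ * (M * |t|) ^ n / (n.factorial : ℝ) := by
  have hM0 : 0 ≤ M := (norm_nonneg _).trans (hM t ht)
  induction n generalizing t with
  | zero => simp [peanoBakerTerm]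
  | succ n ih =>
    have hc : Continuous fun s => A s * peanoBakerTerm A n s :=
      A.continuous.mul (continuous_peanoBakerTerm A n)
    have hd : Continuous fun s : ℝ =>
        M * (‖(1 : R)‖ * M ^ n / (n.factorial : ℝ)) * |s - 0| ^ n := by fun_prop
    calc ‖peanoBakerTerm A (n + 1) t‖
        ≤ ∫ s in uIoc 0 t, ‖A s * peanoBakerTerm A n s‖ :=
          intervalIntegral.norm_integral_le_integral_norm_uIoc
      _ ≤ ∫ s in uIoc 0 t, M * (‖(1 : R)‖ * M ^ n / (n.factorial : ℝ)) * |s - 0| ^ n := by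
          refine setIntegral_mono_on (hc.norm.integrableOn_uIoc) hd.integrableOn_uIoc
            measurableSet_uIoc fun s hs => ?_
          have hs' : |s| ≤ T := by
            refine le_trans ?_ ht
            rcases le_total 0 t with h | h
            · rw [uIoc_of_le h] at hs
              rw [abs_of_pos hs.1, abs_of_nonneg h]; exact hs.2
            · rw [uIoc_of_ge h] at hs
              rw [abs_of_nonpos hs.2, abs_of_nonpos h]; linarith [hs.1]
          calc ‖A s * peanoBakerTerm A n s‖ ≤ ‖A s‖ * ‖peanoBakerTerm A n s‖ := norm_mul_le _ _
            _ ≤ M * (‖(1 : R)‖ * (M * |s|) ^ n / (n.factorial : ℝ)) := by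
                gcongr
                · exact hM s hs'
                · exact ih s hs'
            _ = _ := by rw [sub_zero, mul_pow]; ring
      _ = ‖(1 : R)‖ * (M * |t|) ^ (n + 1) / ((n + 1).factorial : ℝ) := by
          rw [integral_const_mul, integral_pow_abs_sub_uIoc, Nat.factorial_succ]
          push_cast
          rw [sub_zero]
          field_simp
          ring

theorem IsCauchyOperator.unique {R : Type*} [NormedRing R] [NormedSpace ℝ R] {A : C(ℝ, R)}
    {U V : ℝ → R} (hU : IsCauchyOperator A U) (hV : IsCauchyOperator A V) : U = V := by
  ext t
  obtain ⟨M, hM⟩ := (isCompact_Icc (a := -(|t| + 1)) (b := |t| + 1)).exists_bound_of_continuousOn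
    A.continuous.continuousOn
  have ht := abs_nonneg t
  refine ODE_solution_unique_of_mem_Ioo (v := fun s x => A s * x) (s := fun _ => univ)
    (K := M.toNNReal) (a := -(|t| + 1)) (b := |t| + 1) (t₀ := 0) (fun s hs => ?_)
    ⟨by linarith, by linarith⟩ (fun s _ => ⟨hU.2 s, mem_univ _⟩)
    (fun s _ => ⟨hV.2 s, mem_univ _⟩) (hU.1.trans hV.1.symm)
    ⟨by linarith [neg_abs_le t], by linarith [le_abs_self t]⟩
  refine (LipschitzWith.of_dist_le_mul fun x y => ?_).lipschitzOnWith
  rw [dist_eq_norm, dist_eq_norm, ← mul_sub]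
  refine (norm_mul_le _ _).trans ?_
  gcongr
  exact (hM s (Ioo_subset_Icc_self hs)).trans (Real.le_coe_toNNReal M)

/-- A linear equation with continuous coefficient has exactly one Cauchy operator. -/
theorem existsUnique_isCauchyOperator {R : Type*} [NormedRing R] [NormedSpace ℝ R]
    [CompleteSpace R] (A : C(ℝ, R)) : ∃! U : ℝ → R, IsCauchyOperator A U := by
  have hbd : ∀ T : ℝ, ∃ M : ℝ, ∀ t, |t| ≤ T → ‖A t‖ ≤ M := fun T => by
    obtain ⟨M, hM⟩ := (isCompact_Icc (a := -T) (b := T)).exists_bound_of_continuousOn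
      A.continuous.continuousOn
    exact ⟨M, fun t ht => hM t (abs_le.1 ht)⟩
  refine existsUnique_of_exists_of_unique ⟨fun t => ∑' n, peanoBakerTerm A n t, ?_, fun t => ?_⟩
    fun _ _ hU hV => hU.unique hV
  · show ∑' n, peanoBakerTerm A n 0 = 1
    rw [tsum_eq_single 0]
    · rfl
    · intro n hn
      obtain ⟨k, rfl⟩ := Nat.exists_eq_succ_of_ne_zero hn
      simp [peanoBakerTerm]
  · obtain ⟨M, hM⟩ := hbd (|t| + 1)
    have hM0 : 0 ≤ M := (norm_nonneg _).trans (hM t (by linarith))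
    have hT : 0 ≤ |t| + 1 := by positivity
    have hle : ∀ n s, |s| ≤ |t| + 1 → ‖peanoBakerTerm A n s‖
        ≤ ‖(1 : R)‖ * ((M * (|t| + 1)) ^ n / (n.factorial : ℝ)) := fun n s hs => by
      refine (norm_peanoBakerTerm_le A hM n s hs).trans ?_
      rw [mul_div_assoc]
      gcongr
    have hsum : Summable fun n : ℕ =>
        ‖(1 : R)‖ * ((M * (|t| + 1)) ^ n / (n.factorial : ℝ)) :=
      (Real.summable_pow_div_factorial _).mul_left _
    have hs0 : ∀ s, |s| ≤ |t| + 1 → Summable fun n => peanoBakerTerm A n s := fun s hs =>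
      Summable.of_norm_bounded hsum fun n => hle n s hs
    have hmem : ∀ s, s ∈ Metric.ball (0 : ℝ) (|t| + 1) → |s| ≤ |t| + 1 := fun s hs => by
      rw [mem_ball_zero_iff, Real.norm_eq_abs] at hs
      exact hs.le
    have htm : t ∈ Metric.ball (0 : ℝ) (|t| + 1) := by
      rw [mem_ball_zero_iff, Real.norm_eq_abs]; linarith
    have key := hasDerivAt_tsum_of_isPreconnected (hsum.mul_left M)
      (g := fun n => peanoBakerTerm A (n + 1))
      (g' := fun n s => A s * peanoBakerTerm A n s) Metric.isOpen_ball
      (convex_ball (0 : ℝ) (|t| + 1)).isPreconnected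
      (fun n s _ => hasDerivAt_peanoBakerTerm A n s)
      (fun n s hs => (norm_mul_le _ _).trans
        (mul_le_mul (hM s (hmem s hs)) (hle n s (hmem s hs)) (norm_nonneg _) hM0))
      htm ((summable_nat_add_iff 1).2 (hs0 t (hmem t htm))) htm
    rw [(hs0 t (hmem t htm)).tsum_mul_left] at key
    refine (key.const_add 1).congr_of_eventuallyEq ?_
    filter_upwards [Metric.isOpen_ball.mem_nhds htm] with s hs
    exact (hs0 s (hmem s hs)).tsum_eq_zero_add

section Equation

variable {𝕜 E : Type*} [RCLike 𝕜] [NormedAddCommGroup E] [NormedSpace ℝ E] [NormedSpace 𝕜 E]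
  [IsScalarTower ℝ 𝕜 E] [CompleteSpace E]

/-- The Cauchy operator `U(t, A)` of the equation `x' = A(t) x`: the unique operator-valued
function with `U(0, A) = I` and `U'(t, A) = A(t) U(t, A)` for all real `t`. -/
noncomputable def cauchyOperator (A : C(ℝ, E →L[𝕜] E)) : ℝ → E →L[𝕜] E :=
  (existsUnique_isCauchyOperator A).choose

theorem isCauchyOperator_cauchyOperator (A : C(ℝ, E →L[𝕜] E)) :
    IsCauchyOperator A (cauchyOperator A) :=
  (existsUnique_isCauchyOperator A).choose_spec.1

/-- The operator `U(t, A) S U⁻¹(τ, A)`. -/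
noncomputable def transport (A : C(ℝ, E →L[𝕜] E)) (S : E →L[𝕜] E) (t τ : ℝ) : E →L[𝕜] E :=
  cauchyOperator A t * S * Ring.inverse (cauchyOperator A τ)

/-- The equation `x' = A(t) x` has an exponential trichotomy on `ℝ` with the (bounded linear)
projections `P` and `Q`. -/
structure IsExponentialTrichotomy (A : C(ℝ, E →L[𝕜] E)) (P Q : E →L[𝕜] E) : Prop where
  proj_P : P * P = P
  proj_Q : Q * Q = Q
  comm : P * Q = Q * P
  add_sub : P + Q - P * Q = 1
  bounds : ∃ N ν : ℝ, 1 ≤ N ∧ 0 < ν ∧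
    (∀ t τ : ℝ, 0 ≤ τ → τ ≤ t → ‖transport A P t τ‖ ≤ N * Real.exp (-ν * (t - τ))) ∧
    (∀ t τ : ℝ, t ≤ τ → 0 ≤ τ → ‖transport A (1 - P) t τ‖ ≤ N * Real.exp (-ν * (τ - t))) ∧
    (∀ t τ : ℝ, t ≤ τ → τ ≤ 0 → ‖transport A Q t τ‖ ≤ N * Real.exp (-ν * (τ - t))) ∧
    (∀ t τ : ℝ, τ ≤ t → τ ≤ 0 → ‖transport A (1 - Q) t τ‖ ≤ N * Real.exp (-ν * (t - τ)))

open Classical in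
/-- The Green function `G_A(t, τ)` of an equation with exponential trichotomy with projections
`P`, `Q`. The four cases are tried in order: they overlap only where `τ = 0` or `τ = t`. -/
noncomputable def greenFunction (A : C(ℝ, E →L[𝕜] E)) (P Q : E →L[𝕜] E) (t τ : ℝ) :
    E →L[𝕜] E :=
  if 0 ≤ τ ∧ τ < t then transport A P t τ
  else if t ≤ τ ∧ 0 ≤ τ then -transport A (1 - P) t τ
  else if t ≤ τ ∧ τ ≤ 0 then -transport A Q t τ
  else transport A (1 - Q) t τ

/-- `φ` is a solution on `ℝ` of the equation `x' = A(t) x + f(t)`. -/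
def IsSolution (A : C(ℝ, E →L[𝕜] E)) (f φ : C(ℝ, E)) : Prop :=
  ∀ t : ℝ, HasDerivAt φ (A t (φ t) + f t) t

/-- The shift dynamical system on the pairs `(A, f) ∈ C(ℝ, [E]) × C(ℝ, E)`. -/
def coeffFlow (𝕜 E : Type*) [RCLike 𝕜] [NormedAddCommGroup E] [NormedSpace 𝕜 E] :
    Flow ℝ (C(ℝ, E →L[𝕜] E) × C(ℝ, E)) :=
  prodFlow (shiftFlow (E →L[𝕜] E)) (shiftFlow E)

/-- `φ` is two-sided remotely compatible (with the coefficients): `𝔏_{(A, f)} ⊆ 𝔏_φ`. -/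
def TwoSidedRemotelyCompatible (A : C(ℝ, E →L[𝕜] E)) (f φ : C(ℝ, E)) : Prop :=
  limitSeq (coeffFlow 𝕜 E) (A, f) ⊆ limitSeq (shiftFlow E) φ

end Equation

/-! ### Invertibility of the Cauchy operator. -/

section Inverse

variable {R : Type*} [NormedRing R] [NormedSpace ℝ R] [IsScalarTower ℝ R R]
  [SMulCommClass ℝ R R]

/-! Every bounded solution `φ` is compatible, by comparing it with its own translates. If `(A, f)`
converges along `t_n`, then `χ(s) = φ(s) - φ(s + t_n - t_m)` is bounded by `2M` and solves `χ' = Aχ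
+ h`, with `h` small on a long interval around `t_m`. For `|t_m|` large this interval lies in a
half-line where the trichotomy is a dichotomy, with projection `P` near `+∞` and `1 - Q` near `-∞`.
Splitting `χ` at the centre and transporting one part from the left end and the other from the right
end makes `χ` small there (`norm_le_of_dichotomy`). So the translates of `φ` are Cauchy, and
completeness of `C(ℝ, E)` gives convergence with no limit equation.

It remains to see that the Green integral is a bounded solution. Lagrange stability makes `f`
bounded and `G_A` decays exponentially in `|τ - t|`, which gives absolute convergence and a uniform
bound. Since `G_A(t, τ)` is `U(t) G_A(0, τ)` plus or minus `U(t) U⁻¹(τ)` for `τ` between `0` and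
`t`, the integral has the variation of constants form. -/

theorem hasDerivAt_mul_of_smulCommClass {u v : ℝ → R} {u' v' : R} {t : ℝ}
    (hu : HasDerivAt u u' t) (hv : HasDerivAt v v' t) :
    HasDerivAt (fun s => u s * v s) (u' * v t + u t * v') t := by
  have h := (ContinuousLinearMap.mul ℝ R).hasDerivAt_of_bilinear (fun _ => hu) (fun _ => hv)
  simpa [add_comm] using! h

/-- The Cauchy operator has a two-sided inverse `V`, which solves the adjoint equation. -/
theorem IsCauchyOperator.exists_inverse [CompleteSpace R] {A : C(ℝ, R)} {U : ℝ → R}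
    (hU : IsCauchyOperator A U) :
    ∃ V : ℝ → R, (∀ t, V t * U t = 1) ∧ (∀ t, U t * V t = 1) ∧
      ∀ t, HasDerivAt V (-(V t * A t)) t := by
  -- Read in the opposite ring, `W' = -A W` becomes `V' = -V A`, so the existence theorem also
  -- supplies the adjoint solution.
  obtain ⟨W, ⟨hW0, hW⟩, -⟩ := existsUnique_isCauchyOperator (R := Rᵐᵒᵖ)
    ⟨fun t => MulOpposite.op (-A t), by fun_prop⟩
  have hV : ∀ t, HasDerivAt (fun s => (W s).unop) (-((W t).unop * A t)) t := fun t => by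
    have h := ((MulOpposite.opContinuousLinearEquiv ℝ (M := R)).symm.toContinuousLinearMap
      |>.hasFDerivAt).comp_hasDerivAt t (hW t)
    simpa using! h
  have hU0 := hU.1
  refine ⟨fun s => (W s).unop, fun t => ?_, fun t => ?_, hV⟩
  · have hd : ∀ s, HasDerivAt (fun s => (W s).unop * U s) 0 s := fun s => by
      have h := hasDerivAt_mul_of_smulCommClass (hV s) (hU.2 s)
      simpa [mul_assoc] using h
    have := is_const_of_deriv_eq_zero (fun s => (hd s).differentiableAt)
      (fun s => (hd s).deriv) t 0
    simpa [hU0, hW0] using this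
  -- A left inverse need not be a right inverse in infinite dimension. But `UV` solves `X' = AX -
  -- XA`, as does the constant `1`, and uniqueness applies with Lipschitz constant `2M`.
  · have hd : ∀ s, HasDerivAt (fun s => U s * (W s).unop)
        (A s * (U s * (W s).unop) - (U s * (W s).unop) * A s) s := fun s => by
      have h := hasDerivAt_mul_of_smulCommClass (hU.2 s) (hV s)
      simpa [mul_assoc, sub_eq_add_neg] using h
    obtain ⟨M, hM⟩ := (isCompact_Icc (a := -(|t| + 1))
      (b := |t| + 1)).exists_bound_of_continuousOn A.continuous.continuousOn
    have ht := abs_nonneg t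
    have key := ODE_solution_unique_of_mem_Ioo (v := fun s x => A s * x - x * A s)
      (s := fun _ => univ) (f := fun s => U s * (W s).unop) (g := fun _ => (1 : R))
      (K := (2 * M).toNNReal) (a := -(|t| + 1)) (b := |t| + 1) (t₀ := 0) (fun s hs => ?_)
      ⟨by linarith, by linarith⟩ (fun s _ => ⟨hd s, mem_univ _⟩)
      (fun s _ => ⟨by simpa using hasDerivAt_const s (1 : R), mem_univ _⟩)
      (by simp [hU0, hW0])
    · exact key ⟨by linarith [neg_abs_le t], by linarith [le_abs_self t]⟩
    · refine (LipschitzWith.of_dist_le_mul fun x y => ?_).lipschitzOnWith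
      have hs' := hM s (Ioo_subset_Icc_self hs)
      rw [dist_eq_norm, dist_eq_norm]
      calc ‖A s * x - x * A s - (A s * y - y * A s)‖
          = ‖A s * (x - y) - (x - y) * A s‖ := by congr 1; noncomm_ring
        _ ≤ ‖A s‖ * ‖x - y‖ + ‖x - y‖ * ‖A s‖ :=
          (norm_sub_le _ _).trans (add_le_add (norm_mul_le _ _) (norm_mul_le _ _))
        _ = 2 * ‖A s‖ * ‖x - y‖ := by ring
        _ ≤ (2 * M).toNNReal * ‖x - y‖ := by
          gcongr
          exact (by linarith : 2 * ‖A s‖ ≤ 2 * M).trans (Real.le_coe_toNNReal _)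

end Inverse

/-! ### Variation of constants and the dichotomy estimate. -/

section Equation

variable {𝕜 E : Type*} [RCLike 𝕜] [NormedAddCommGroup E] [NormedSpace ℝ E] [NormedSpace 𝕜 E]
  [IsScalarTower ℝ 𝕜 E] [CompleteSpace E]

/-- The inverse `U⁻¹(t, A)` of the Cauchy operator. -/
noncomputable def cauchyInverse (A : C(ℝ, E →L[𝕜] E)) (t : ℝ) : E →L[𝕜] E :=
  Ring.inverse (cauchyOperator A t)

/-- `U(t)` is a unit, so `Ring.inverse` is its true inverse and not the default value `0`. -/
theorem cauchyInverse_spec (A : C(ℝ, E →L[𝕜] E)) :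
    (∀ t, cauchyOperator A t * cauchyInverse A t = 1) ∧
      ∀ t, HasDerivAt (cauchyInverse A) (-(cauchyInverse A t * A t)) t := by
  obtain ⟨V, hVU, hUV, hV⟩ := (isCauchyOperator_cauchyOperator A).exists_inverse
  have h : cauchyInverse A = V := funext fun t =>
    Ring.inverse_unit (⟨cauchyOperator A t, V t, hUV t, hVU t⟩ : (E →L[𝕜] E)ˣ)
  exact h ▸ ⟨hUV, hV⟩

theorem cauchyOperator_mul_cauchyInverse (A : C(ℝ, E →L[𝕜] E)) (t : ℝ) :
    cauchyOperator A t * cauchyInverse A t = 1 :=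
  (cauchyInverse_spec A).1 t

theorem hasDerivAt_cauchyInverse (A : C(ℝ, E →L[𝕜] E)) (t : ℝ) :
    HasDerivAt (cauchyInverse A) (-(cauchyInverse A t * A t)) t :=
  (cauchyInverse_spec A).2 t

theorem continuous_cauchyInverse (A : C(ℝ, E →L[𝕜] E)) : Continuous (cauchyInverse A) :=
  continuous_iff_continuousAt.2 fun t => (hasDerivAt_cauchyInverse A t).continuousAt

theorem transport_eq (A : C(ℝ, E →L[𝕜] E)) (S : E →L[𝕜] E) (t τ : ℝ) :
    transport A S t τ = cauchyOperator A t * S * cauchyInverse A τ := rfl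

theorem continuous_transport (A : C(ℝ, E →L[𝕜] E)) (S : E →L[𝕜] E) (t : ℝ) :
    Continuous (transport A S t) :=
  continuous_const.mul (continuous_cauchyInverse A)

omit [CompleteSpace E] in
theorem HasDerivAt.clm_apply_of_isScalarTower {B : ℝ → E →L[𝕜] E} {B' : E →L[𝕜] E} {x : ℝ → E}
    {x' : E} {t : ℝ} (hB : HasDerivAt B B' t) (hx : HasDerivAt x x' t) :
    HasDerivAt (fun s => B s (x s)) (B' (x t) + B t x') t := by
  -- Time is real while the operators are `𝕜`-linear; after restriction of scalars, evaluation is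
  -- real bilinear.
  have h := (ContinuousLinearMap.restrictScalarsL 𝕜 E E ℝ ℝ).hasDerivAt_of_bilinear
    (fun _ => hB) (fun _ => hx)
  simpa [add_comm] using! h

/-- Variation of constants, transported by `U(t) S U⁻¹(τ)`. -/
theorem hasDerivAt_transport_apply (A : C(ℝ, E →L[𝕜] E)) (S : E →L[𝕜] E) (t : ℝ) {x : ℝ → E}
    {h : E} {τ : ℝ} (hx : HasDerivAt x (A τ (x τ) + h) τ) :
    HasDerivAt (fun s => transport A S t s (x s)) (transport A S t τ h) τ := by
  have h1 := (hasDerivAt_cauchyInverse A τ).clm_apply_of_isScalarTower hx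
  have h2 := (hasDerivAt_const τ (cauchyOperator A t * S)).clm_apply_of_isScalarTower h1
  -- The term `-U⁻¹ A x` from the derivative of `U⁻¹` cancels `U⁻¹ A x`, leaving only the forcing.
  simpa [transport_eq] using h2

theorem transport_add_transport_one_sub (A : C(ℝ, E →L[𝕜] E)) (S : E →L[𝕜] E) (t : ℝ) :
    transport A S t t + transport A (1 - S) t t = 1 := by
  rw [transport_eq, transport_eq, ← add_mul, ← mul_add, add_sub_cancel, mul_one,
    cauchyOperator_mul_cauchyInverse]

/-- The derivative of `U(t) S U⁻¹(s) χ(s)` in `s` involves only `h`, so its increment is an integral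
of small terms. -/
theorem norm_transport_integral_le {A : C(ℝ, E →L[𝕜] E)} {S : E →L[𝕜] E} {t a b N ε : ℝ}
    {χ h : ℝ → E} (hab : a ≤ b) (hχ : ∀ s, HasDerivAt χ (A s (χ s) + h s) s)
    (hh : Continuous h) (hN0 : 0 ≤ N) (hN : ∀ τ ∈ Icc a b, ‖transport A S t τ‖ ≤ N)
    (hε : ∀ τ ∈ Icc a b, ‖h τ‖ ≤ ε) :
    ‖transport A S t b (χ b) - transport A S t a (χ a)‖ ≤ N * ε * (b - a) := by
  rw [← abs_of_nonneg (sub_nonneg.2 hab), ← intervalIntegral.integral_eq_sub_of_hasDerivAt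
    (fun s _ => hasDerivAt_transport_apply A S t (hχ s))
    (((continuous_transport A S t).clm_apply hh).intervalIntegrable a b)]
  refine intervalIntegral.norm_integral_le_of_norm_le_const fun s hs => ?_
  rw [uIoc_of_le hab] at hs
  have hs' := Ioc_subset_Icc_self hs
  exact (ContinuousLinearMap.le_opNorm _ _).trans
    (mul_le_mul (hN s hs') (hε s hs') (norm_nonneg _) hN0)

/-- A solution of a perturbed equation that is bounded by `M` is small at the centre of an interval
on which the equation has a dichotomy and the perturbation is small. -/
theorem norm_le_of_dichotomy {A : C(ℝ, E →L[𝕜] E)} {S : E →L[𝕜] E} {t L N ν M ε : ℝ}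
    {χ h : ℝ → E} (hL : 0 ≤ L) (hN : 0 ≤ N) (hν : 0 ≤ ν)
    (hχ : ∀ s, HasDerivAt χ (A s (χ s) + h s) s) (hh : Continuous h)
    (hS : ∀ τ ∈ Icc (t - L) t, ‖transport A S t τ‖ ≤ N * Real.exp (-ν * (t - τ)))
    (hS' : ∀ τ ∈ Icc t (t + L), ‖transport A (1 - S) t τ‖ ≤ N * Real.exp (-ν * (τ - t)))
    (hM : ∀ s, ‖χ s‖ ≤ M) (hε : ∀ τ ∈ Icc (t - L) (t + L), ‖h τ‖ ≤ ε) :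
    ‖χ t‖ ≤ 2 * N * M * Real.exp (-ν * L) + 2 * N * ε * L := by
  have hexp : ∀ x, 0 ≤ x → N * Real.exp (-ν * x) ≤ N := fun x hx =>
    mul_le_of_le_one_right hN (Real.exp_le_one_iff.2 (by nlinarith))
  have h1 := norm_transport_integral_le (a := t - L) (b := t) (by linarith) hχ hh hN
    (fun τ hτ => (hS τ hτ).trans (hexp _ (by linarith [hτ.2])))
    (fun τ hτ => hε τ ⟨hτ.1, by linarith [hτ.2]⟩)
  have h2 := norm_transport_integral_le (a := t) (b := t + L) (by linarith) hχ hh hN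
    (fun τ hτ => (hS' τ hτ).trans (hexp _ (by linarith [hτ.1])))
    (fun τ hτ => hε τ ⟨by linarith [hτ.1], hτ.2⟩)
  have h3 : ‖transport A S t (t - L) (χ (t - L))‖ ≤ N * Real.exp (-ν * L) * M := by
    refine (ContinuousLinearMap.le_opNorm _ _).trans (mul_le_mul ?_ (hM _) (norm_nonneg _)
      (by positivity))
    simpa using hS (t - L) ⟨le_rfl, by linarith⟩
  have h4 : ‖transport A (1 - S) t (t + L) (χ (t + L))‖ ≤ N * Real.exp (-ν * L) * M := by
    refine (ContinuousLinearMap.le_opNorm _ _).trans (mul_le_mul ?_ (hM _) (norm_nonneg _)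
      (by positivity))
    simpa using hS' (t + L) ⟨by linarith, le_rfl⟩
  have hsum : χ t = transport A S t t (χ t) + transport A (1 - S) t t (χ t) := by
    rw [← add_apply, transport_add_transport_one_sub]; rfl
  -- The `S` part comes from `t - L` and the complementary part from `t + L`: each boundary term
  -- costs `N M exp(-νL)`, each increment `N ε L`.
  have heq : χ t = (transport A S t t (χ t) - transport A S t (t - L) (χ (t - L)))
      - (transport A (1 - S) t (t + L) (χ (t + L)) - transport A (1 - S) t t (χ t))
      + transport A S t (t - L) (χ (t - L))
      + transport A (1 - S) t (t + L) (χ (t + L)) := by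
    conv_lhs => rw [hsum]
    abel
  rw [heq]
  refine (norm_add_le_of_le (norm_add_le_of_le (norm_sub_le_of_le h1 h2) h3) h4).trans
    (le_of_eq ?_)
  ring

end Equation

/-! ### Remote compatibility of bounded solutions. -/

theorem cauchySeq_shiftFlow_iff {X : Type*} [SeminormedAddCommGroup X] {φ : C(ℝ, X)}
    {t : ℕ → ℝ} :
    CauchySeq (fun n => shiftFlow X (t n) φ) ↔ ∀ K ε : ℝ, 0 < ε → ∃ n₀, ∀ m ≥ n₀, ∀ n ≥ n₀,
      ∀ y : ℝ, |y| ≤ K → ‖φ (y + t m) - φ (y + t n)‖ < ε := by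
  rw [(Metric.uniformity_basis_dist.compactConvergenceUniformity (α := ℝ)).cauchySeq_iff]
  constructor
  · intro h K ε hε
    obtain ⟨n₀, hn₀⟩ := h (Icc (-K) K, ε) ⟨isCompact_Icc, hε⟩
    refine ⟨n₀, fun m hm n hn y hy => ?_⟩
    have := hn₀ m hm n hn y (abs_le.1 hy)
    simpa [dist_eq_norm] using! this
  · rintro h ⟨K, ε⟩ ⟨hK, hε⟩
    obtain ⟨C, hC⟩ := hK.isBounded.exists_norm_le
    obtain ⟨n₀, hn₀⟩ := h C ε hε
    refine ⟨n₀, fun m hm n hn y hy => ?_⟩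
    have := hn₀ m hm n hn y (hC y hy)
    rw [← dist_eq_norm] at this
    exact this

section Equation

variable {𝕜 E : Type*} [RCLike 𝕜] [NormedAddCommGroup E] [NormedSpace ℝ E] [NormedSpace 𝕜 E]
  [IsScalarTower ℝ 𝕜 E] [CompleteSpace E]

/-- The equation `x' = A(t) x` has an exponential dichotomy with the projection `S` on the set `J`
of times. -/
def HasDichotomyBounds (A : C(ℝ, E →L[𝕜] E)) (S : E →L[𝕜] E) (J : Set ℝ) (N ν : ℝ) : Prop :=
  (∀ t ∈ J, ∀ τ ∈ J, τ ≤ t → ‖transport A S t τ‖ ≤ N * Real.exp (-ν * (t - τ))) ∧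
    ∀ t ∈ J, ∀ τ ∈ J, t ≤ τ → ‖transport A (1 - S) t τ‖ ≤ N * Real.exp (-ν * (τ - t))

theorem cauchySeq_shiftFlow_of_dichotomy {A : C(ℝ, E →L[𝕜] E)} {f φ : C(ℝ, E)} {S : E →L[𝕜] E}
    {J : Set ℝ} {N ν M : ℝ} {t : ℕ → ℝ} (hN : 0 ≤ N) (hν : 0 < ν)
    (hJ : HasDichotomyBounds A S J N ν)
    (ht : ∀ K : ℝ, ∀ᶠ n in atTop, Icc (t n - K) (t n + K) ⊆ J)
    (hφ : IsSolution A f φ) (hM : ∀ s, ‖φ s‖ ≤ M)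
    (hA : CauchySeq fun n => shiftFlow (E →L[𝕜] E) (t n) A)
    (hf : CauchySeq fun n => shiftFlow E (t n) f) :
    CauchySeq fun n => shiftFlow E (t n) φ := by
  rw [cauchySeq_shiftFlow_iff] at hA hf ⊢
  intro K ε hε
  have hM0 : 0 ≤ M := (norm_nonneg _).trans (hM 0)
  -- `L` is fixed first to kill the boundary terms; only then is `δ` chosen, depending on `L`, for
  -- the forcing.
  obtain ⟨L, hL, hL0⟩ : ∃ L, 2 * N * (2 * M) * Real.exp (-ν * L) < ε / 2 ∧ 0 ≤ L := by
    have h : Tendsto (fun L : ℝ => 2 * N * (2 * M) * Real.exp (-ν * L)) atTop (𝓝 0) := by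
      have := (Real.tendsto_exp_atBot.comp (tendsto_id.const_mul_atTop_of_neg
        (neg_lt_zero.2 hν))).const_mul (2 * N * (2 * M))
      simpa [Function.comp_def] using this
    exact ((h.eventually_lt_const (half_pos hε)).and (eventually_ge_atTop 0)).exists
  obtain ⟨δ, hδ, hδε⟩ := exists_pos_mul_lt (half_pos hε) (2 * N * (M + 1) * L)
  obtain ⟨n₁, hn₁⟩ := hA (K + L) δ hδ
  obtain ⟨n₂, hn₂⟩ := hf (K + L) δ hδ
  obtain ⟨n₃, hn₃⟩ := eventually_atTop.1 (ht (K + L))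
  refine ⟨max n₁ (max n₂ n₃), fun m hm n hn y hy => ?_⟩
  simp only [ge_iff_le, max_le_iff] at hm hn
  have hy' := abs_le.1 hy
  -- The dichotomy is needed around `t m` only: the translated solution enters through its bound and
  -- the perturbation.
  have hmem : ∀ τ ∈ Icc (y + t m - L) (y + t m + L), τ ∈ J := fun τ hτ =>
    hn₃ m hm.2.2 ⟨by linarith [hτ.1], by linarith [hτ.2]⟩
  have hc : y + t m ∈ J := hmem _ ⟨by linarith, by linarith⟩
  have hχ : ∀ s, HasDerivAt (fun s => φ s - φ (s + (t n - t m)))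
      (A s (φ s - φ (s + (t n - t m))) + ((A s - A (s + (t n - t m))) (φ (s + (t n - t m)))
        + (f s - f (s + (t n - t m))))) s := fun s => by
    refine ((hφ s).sub ((hφ (s + (t n - t m))).comp_add_const s (t n - t m))).congr_deriv ?_
    simp only [map_sub, sub_apply]
    abel
  have key := norm_le_of_dichotomy (t := y + t m) (S := S) (M := 2 * M) (ε := δ * (M + 1))
    hL0 hN hν.le hχ (by fun_prop)
    (fun τ hτ => hJ.1 _ hc _ (hmem τ ⟨hτ.1, by linarith [hτ.2]⟩) hτ.2)
    (fun τ hτ => hJ.2 _ hc _ (hmem τ ⟨by linarith [hτ.1], hτ.2⟩) hτ.1)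
    (fun s => (norm_sub_le_of_le (hM _) (hM _)).trans (by linarith))
    (fun τ hτ => by
      have hτK : |τ - t m| ≤ K + L := abs_le.2 ⟨by linarith [hτ.1], by linarith [hτ.2]⟩
      have h1 := hn₁ m hm.1 n hn.1 _ hτK
      have h2 := hn₂ m hm.2.1 n hn.2.1 _ hτK
      have e1 : τ - t m + t m = τ := by ring
      have e2 : τ - t m + t n = τ + (t n - t m) := by ring
      rw [e1, e2] at h1 h2
      refine (norm_add_le_of_le ((ContinuousLinearMap.le_opNorm _ _).trans
        (mul_le_mul h1.le (hM _) (norm_nonneg _) hδ.le)) h2.le).trans (le_of_eq (by ring)))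
  have e : y + t m + (t n - t m) = y + t n := by ring
  simp only [e] at key
  calc _ ≤ _ := key
    _ < ε / 2 + ε / 2 := add_lt_add hL (lt_of_eq_of_lt (by ring) hδε)
    _ = ε := add_halves ε

/-- On the negative half-line `Q` is the part that decays backwards, so the forward-stable
projection is `1 - Q`. -/
theorem IsExponentialTrichotomy.exists_dichotomyBounds {A : C(ℝ, E →L[𝕜] E)} {P Q : E →L[𝕜] E}
    (h : IsExponentialTrichotomy A P Q) :
    ∃ N ν : ℝ, 0 ≤ N ∧ 0 < ν ∧ HasDichotomyBounds A P (Ici 0) N ν ∧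
      HasDichotomyBounds A (1 - Q) (Iic 0) N ν := by
  obtain ⟨N, ν, hN, hν, h1, h2, h3, h4⟩ := h.bounds
  refine ⟨N, ν, by linarith, hν, ⟨fun t _ τ hτ h => h1 t τ hτ h, fun t _ τ hτ h => h2 t τ h hτ⟩,
    fun t _ τ hτ h => h4 t τ h hτ, fun t _ τ hτ h => ?_⟩
  rw [sub_sub_cancel]
  exact h3 t τ h hτ

/-- Bounded solutions of an equation with exponential trichotomy are two-sided remotely
compatible. -/
theorem IsExponentialTrichotomy.twoSidedRemotelyCompatible {A : C(ℝ, E →L[𝕜] E)} {f φ : C(ℝ, E)}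
    {P Q : E →L[𝕜] E} (h : IsExponentialTrichotomy A P Q) (hφ : IsSolution A f φ) {M : ℝ}
    (hM : ∀ s, ‖φ s‖ ≤ M) : TwoSidedRemotelyCompatible A f φ := by
  obtain ⟨N, ν, hN, hν, hP, hQ⟩ := h.exists_dichotomyBounds
  have hcauchy : ∀ t : ℕ → ℝ, (∃ p, Tendsto (fun n => coeffFlow 𝕜 E (t n) (A, f)) atTop (𝓝 p)) →
      (CauchySeq fun n => shiftFlow (E →L[𝕜] E) (t n) A) ∧
        CauchySeq fun n => shiftFlow E (t n) f := by
    rintro t ⟨p, hp⟩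
    have h1 := (continuous_fst.tendsto p).comp hp
    have h2 := (continuous_snd.tendsto p).comp hp
    exact ⟨h1.cauchySeq, h2.cauchySeq⟩
  rintro t (⟨hp, ht⟩ | ⟨hp, ht⟩)
  · obtain ⟨hA, hf⟩ := hcauchy t hp
    refine Or.inl ⟨cauchySeq_tendsto_of_complete (cauchySeq_shiftFlow_of_dichotomy hN hν hQ
      (fun K => ?_) hφ hM hA hf), ht⟩
    filter_upwards [ht.eventually_le_atBot (-K)] with n hn τ hτ
    exact hτ.2.trans (by linarith)
  · obtain ⟨hA, hf⟩ := hcauchy t hp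
    refine Or.inr ⟨cauchySeq_tendsto_of_complete (cauchySeq_shiftFlow_of_dichotomy hN hν hP
      (fun K => ?_) hφ hM hA hf), ht⟩
    filter_upwards [ht.eventually_ge_atTop K] with n hn τ hτ
    exact le_trans (by linarith) hτ.1

end Equation

/-! ### The Green function and its integral. -/

theorem integrable_exp_neg_mul_abs {ν : ℝ} (hν : 0 < ν) :
    Integrable fun x : ℝ => Real.exp (-ν * |x|) := by
  rw [← integrableOn_univ, ← Iic_union_Ioi (a := (0 : ℝ))]
  refine IntegrableOn.union ?_ ?_
  · refine (integrableOn_exp_mul_Iic hν 0).congr_fun (fun x hx => ?_) measurableSet_Iic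
    simp only [abs_of_nonpos (mem_Iic.1 hx)]
    congr 1; ring
  · refine (integrableOn_exp_mul_Ioi (neg_lt_zero.2 hν) 0).congr_fun (fun x hx => ?_)
      measurableSet_Ioi
    simp only [abs_of_pos (mem_Ioi.1 hx)]

/-- Evaluation at `0` is continuous and sends `f^t` to `f t`, so it maps the compact hull to a
bounded set containing all values of `f`. -/
theorem LagrangeStable.exists_norm_le {X : Type*} [SeminormedAddCommGroup X] {Y : Type*}
    [TopologicalSpace Y] {π : Flow ℝ Y} {y : Y} {f : C(ℝ, X)}
    (h : LagrangeStable (prodFlow π (shiftFlow X)) (y, f)) : ∃ C, ∀ t, ‖f t‖ ≤ C := by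
  have hc : Continuous fun p : Y × C(ℝ, X) => p.2 0 := by fun_prop
  obtain ⟨C, hC⟩ := (h.image hc).isBounded.exists_norm_le
  refine ⟨C, fun t => hC _ ⟨_, subset_closure ⟨t, rfl⟩, ?_⟩⟩
  simp [prodFlow, shiftFlow]

section Equation

variable {𝕜 E : Type*} [RCLike 𝕜] [NormedAddCommGroup E] [NormedSpace ℝ E] [NormedSpace 𝕜 E]
  [IsScalarTower ℝ 𝕜 E] [CompleteSpace E]

/-- The trichotomy bounds constrain the sign of `τ` but let `t` cross `0`, so they cover all four
cases. -/
theorem norm_greenFunction_le {A : C(ℝ, E →L[𝕜] E)} {P Q : E →L[𝕜] E}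
    (h : IsExponentialTrichotomy A P Q) :
    ∃ N ν : ℝ, 0 ≤ N ∧ 0 < ν ∧
      ∀ t τ, ‖greenFunction A P Q t τ‖ ≤ N * Real.exp (-ν * |τ - t|) := by
  obtain ⟨N, ν, hN, hν, h1, h2, h3, h4⟩ := h.bounds
  refine ⟨N, ν, by linarith, hν, fun t τ => ?_⟩
  unfold greenFunction
  split_ifs with c1 c2 c3
  · rw [abs_sub_comm, abs_of_nonneg (by linarith)]
    exact h1 t τ c1.1 c1.2.le
  · rw [norm_neg, abs_of_nonneg (by linarith)]
    exact h2 t τ c2.1 c2.2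
  · rw [norm_neg, abs_of_nonneg (by linarith)]
    exact h3 t τ c3.1 c3.2
  · have : τ ≤ t ∧ τ ≤ 0 := by grind
    rw [abs_sub_comm, abs_of_nonneg (by linarith)]
    exact h4 t τ this.1 this.2

theorem stronglyMeasurable_greenFunction (A : C(ℝ, E →L[𝕜] E)) (P Q : E →L[𝕜] E) (t : ℝ) :
    StronglyMeasurable (greenFunction A P Q t) := by
  have hm := fun S => (continuous_transport A S t).stronglyMeasurable
  unfold greenFunction
  refine .ite (measurableSet_Ici.inter measurableSet_Iio) (hm _) (.ite
    (measurableSet_Ici.inter measurableSet_Ici) (hm _).neg (.ite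
    (measurableSet_Ici.inter measurableSet_Iic) (hm _).neg (hm _)))

theorem integrable_greenFunction_apply {A : C(ℝ, E →L[𝕜] E)} {P Q : E →L[𝕜] E}
    (h : IsExponentialTrichotomy A P Q) {f : C(ℝ, E)} {C : ℝ} (hC : ∀ t, ‖f t‖ ≤ C) :
    (∀ t, Integrable fun τ => greenFunction A P Q t τ (f τ)) ∧
      ∃ M, ∀ t, ‖∫ τ, greenFunction A P Q t τ (f τ)‖ ≤ M := by
  obtain ⟨N, ν, hN, hν, hG⟩ := norm_greenFunction_le h
  have hint : Integrable fun x : ℝ => N * Real.exp (-ν * |x|) * C :=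
    ((integrable_exp_neg_mul_abs hν).const_mul N).mul_const C
  have hle : ∀ t τ, ‖greenFunction A P Q t τ (f τ)‖ ≤ N * Real.exp (-ν * |τ - t|) * C :=
    fun t τ => (ContinuousLinearMap.le_opNorm _ _).trans
      (mul_le_mul (hG t τ) (hC τ) (norm_nonneg _) (by positivity))
  refine ⟨fun t => (hint.comp_sub_right t).mono'
    ((isBoundedBilinearMap_apply (𝕜 := 𝕜)).continuous.comp_stronglyMeasurable
      ((stronglyMeasurable_greenFunction A P Q t).prodMk
        f.continuous.stronglyMeasurable)).aestronglyMeasurable (ae_of_all _ (hle t)),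
    ∫ x : ℝ, N * Real.exp (-ν * |x|) * C, fun t => ?_⟩
  rw [← integral_sub_right_eq_self (fun x : ℝ => N * Real.exp (-ν * |x|) * C) t]
  exact norm_integral_le_of_norm_le (hint.comp_sub_right t) (ae_of_all _ (hle t))

theorem transport_sub (A : C(ℝ, E →L[𝕜] E)) (S T : E →L[𝕜] E) (t τ : ℝ) :
    transport A (S - T) t τ = transport A S t τ - transport A T t τ := by
  simp only [transport_eq, mul_sub, sub_mul]

theorem cauchyOperator_zero (A : C(ℝ, E →L[𝕜] E)) : cauchyOperator A 0 = 1 :=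
  (isCauchyOperator_cauchyOperator A).1

theorem cauchyOperator_mul_transport_zero (A : C(ℝ, E →L[𝕜] E)) (S : E →L[𝕜] E) (t τ : ℝ) :
    cauchyOperator A t * transport A S 0 τ = transport A S t τ := by
  rw [transport_eq, transport_eq, cauchyOperator_zero, one_mul, mul_assoc]

/-- The two kernels use the same projection except on `[0, t)`, where the jump is `P + (1 - P) = 1`.
The interval is half-open because the first case requires `τ < t`. -/
theorem greenFunction_eq_of_nonneg (A : C(ℝ, E →L[𝕜] E)) (P Q : E →L[𝕜] E) {t : ℝ} (ht : 0 ≤ t)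
    (τ : ℝ) :
    greenFunction A P Q t τ = cauchyOperator A t * greenFunction A P Q 0 τ
      + (Ico 0 t).indicator (transport A 1 t) τ := by
  unfold greenFunction
  simp only [indicator_apply, mem_Ico, mul_ite, mul_neg, transport_sub, mul_sub,
    cauchyOperator_mul_transport_zero]
  split_ifs <;> first | (exfalso; grind) | abel

/-- Here the jump is `-Q - (1 - Q) = -1` on `[t, 0)`; at `τ = 0` both kernels use `-(1 - P)`. -/
theorem greenFunction_eq_of_nonpos (A : C(ℝ, E →L[𝕜] E)) (P Q : E →L[𝕜] E) {t : ℝ} (ht : t ≤ 0)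
    (τ : ℝ) :
    greenFunction A P Q t τ = cauchyOperator A t * greenFunction A P Q 0 τ
      - (Ico t 0).indicator (transport A 1 t) τ := by
  unfold greenFunction
  simp only [indicator_apply, mem_Ico, mul_ite, mul_neg, transport_sub, mul_sub,
    cauchyOperator_mul_transport_zero]
  split_ifs <;> first | (exfalso; grind) | abel

theorem integral_transport_one_apply (A : C(ℝ, E →L[𝕜] E)) (f : C(ℝ, E)) (t a b : ℝ) :
    ∫ τ in a..b, transport A 1 t τ (f τ)
      = cauchyOperator A t (∫ τ in a..b, cauchyInverse A τ (f τ)) := by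
  rw [← ContinuousLinearMap.intervalIntegral_comp_comm _
    (((continuous_cauchyInverse A).clm_apply f.continuous).intervalIntegrable a b)]
  simp only [transport_eq, mul_one, mul_apply_eq_comp]

/-- The Green integral in terms of its value at `0`, by variation of constants. -/
theorem integral_greenFunction_apply (A : C(ℝ, E →L[𝕜] E)) (P Q : E →L[𝕜] E) (f : C(ℝ, E))
    (hint : Integrable fun τ => greenFunction A P Q 0 τ (f τ)) (t : ℝ) :
    ∫ τ, greenFunction A P Q t τ (f τ) = cauchyOperator A t
      ((∫ τ, greenFunction A P Q 0 τ (f τ)) + ∫ τ in (0 : ℝ)..t, cauchyInverse A τ (f τ)) := by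
  have hc : Continuous fun τ => transport A 1 t τ (f τ) :=
    (continuous_transport A 1 t).clm_apply f.continuous
  have hi : ∀ a b : ℝ, Integrable ((Ico a b).indicator fun τ => transport A 1 t τ (f τ)) :=
    fun a b => (integrable_indicator_iff measurableSet_Ico).2
      (hc.integrableOn_Icc.mono_set Ico_subset_Icc_self)
  have hind : ∀ (s : Set ℝ) (τ : ℝ), s.indicator (transport A 1 t) τ (f τ)
      = s.indicator (fun τ => transport A 1 t τ (f τ)) τ := fun s τ => by
    by_cases h : τ ∈ s <;> simp [h]
  have hU := (cauchyOperator A t).integrable_comp hint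
  rw [map_add, ← integral_transport_one_apply, ← ContinuousLinearMap.integral_comp_comm _ hint]
  rcases le_total 0 t with ht | ht
  · rw [intervalIntegral.integral_of_le ht, ← integral_Ico_eq_integral_Ioc,
      ← integral_indicator measurableSet_Ico, ← integral_add hU (hi _ _)]
    refine integral_congr_ae (ae_of_all _ fun τ => ?_)
    simp only [greenFunction_eq_of_nonneg A P Q ht τ, add_apply, hind,
      mul_apply_eq_comp]
  -- For `t ≤ 0` the minus sign of the jump matches the reversed orientation of the integral from
  -- `0` to `t`.
  · rw [intervalIntegral.integral_of_ge ht, ← integral_Ico_eq_integral_Ioc,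
      ← integral_indicator measurableSet_Ico, ← sub_eq_add_neg, ← integral_sub hU (hi _ _)]
    refine integral_congr_ae (ae_of_all _ fun τ => ?_)
    simp only [greenFunction_eq_of_nonpos A P Q ht τ, sub_apply, hind,
      mul_apply_eq_comp]

theorem hasDerivAt_variation_of_constants (A : C(ℝ, E →L[𝕜] E)) (f : C(ℝ, E)) (c : E) (t : ℝ) :
    HasDerivAt (fun t => cauchyOperator A t (c + ∫ τ in (0 : ℝ)..t, cauchyInverse A τ (f τ)))
      (A t (cauchyOperator A t (c + ∫ τ in (0 : ℝ)..t, cauchyInverse A τ (f τ))) + f t) t := by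
  have hc : Continuous fun τ => cauchyInverse A τ (f τ) :=
    (continuous_cauchyInverse A).clm_apply f.continuous
  have h1 : HasDerivAt (fun t => c + ∫ τ in (0 : ℝ)..t, cauchyInverse A τ (f τ))
      (cauchyInverse A t (f t)) t :=
    (intervalIntegral.integral_hasDerivAt_right (hc.intervalIntegrable 0 t)
      hc.stronglyMeasurable.stronglyMeasurableAtFilter hc.continuousAt).const_add c
  refine (((isCauchyOperator_cauchyOperator A).2 t).clm_apply_of_isScalarTower h1).congr_deriv ?_
  rw [← mul_apply_eq_comp (cauchyOperator A t),
    cauchyOperator_mul_cauchyInverse]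
  rfl

end Equation

theorem theorem5p1 {𝕜 E : Type*} [RCLike 𝕜] [NormedAddCommGroup E] [NormedSpace ℝ E]
    [NormedSpace 𝕜 E] [IsScalarTower ℝ 𝕜 E] [CompleteSpace E]
    (A : C(ℝ, E →L[𝕜] E)) (f : C(ℝ, E))
    (hLagrange : LagrangeStable (coeffFlow 𝕜 E) (A, f))
    (P Q : E →L[𝕜] E) (hTrichotomy : IsExponentialTrichotomy A P Q) :
    (∃ φ : C(ℝ, E), IsSolution A f φ ∧ TwoSidedRemotelyCompatible A f φ ∧
      ∀ t : ℝ, MeasureTheory.Integrable (fun τ : ℝ => greenFunction A P Q t τ (f τ)) ∧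
        φ t = ∫ τ : ℝ, greenFunction A P Q t τ (f τ)) ∧
    (∀ ψ : C(ℝ, E), IsSolution A f ψ → Bornology.IsBounded (Set.range ψ) →
      TwoSidedRemotelyCompatible A f ψ) := by
  refine ⟨?_, fun ψ hψ hb => ?_⟩
  · obtain ⟨C, hC⟩ := LagrangeStable.exists_norm_le hLagrange
    obtain ⟨hint, M, hM⟩ := integrable_greenFunction_apply hTrichotomy hC
    have hsol : ∀ t, HasDerivAt (fun t => ∫ τ, greenFunction A P Q t τ (f τ))
        (A t (∫ τ, greenFunction A P Q t τ (f τ)) + f t) t := fun t => by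
      rw [integral_greenFunction_apply A P Q f (hint 0) t,
        funext (integral_greenFunction_apply A P Q f (hint 0))]
      exact hasDerivAt_variation_of_constants A f _ t
    let φ : C(ℝ, E) := ⟨fun t => ∫ τ, greenFunction A P Q t τ (f τ),
      continuous_iff_continuousAt.2 fun t => (hsol t).continuousAt⟩
    have hφ : IsSolution A f φ := hsol
    exact ⟨φ, hφ, hTrichotomy.twoSidedRemotelyCompatible hφ hM, fun t => ⟨hint t, rfl⟩⟩
  · obtain ⟨M, hM⟩ := hb.exists_norm_le
    exact hTrichotomy.twoSidedRemotelyCompatible hψ fun s => hM _ ⟨s, rfl⟩
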